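/- Let $1\le s_1<s_2<\dots<s_k$ be integers (a finite, possibly empty, list). For every integer $n\ge 1$ with $s_k<n$, let $G=C_{2n}(s_1,s_2,\dots,s_k,n)$ be the circulant graph on the $2n$ vertices $0,1,\dots,2n-1$ in which vertex $i$ is adjacent to the vertices $i\pm s_1,\ i\pm s_2,\dots,\ i\pm s_k$ and $i+n \pmod{2n}$. Let $f_G(n)$ be the number of rooted spanning forests of $G$, that is, of pairs consisting of a spanning acyclic subgraph $F$ of $G$ and a choice of one root vertex in each connected component of $F$. Denote by $p$ the number of odd elements in the sequence $s_1,s_2,\dots,s_k$, and let $q$ and $r$ be the square-free parts of $4p+1$ and $4p+3$ respectively (the square-free part of a positive integer $m$ is the unique square-free positive integer $u$ such that $m=u\,t^2$ for some positive integer $t$). Then there exists an integer sequence $a(n)$ such that, for all such $n$, 1. $f_G(n)=q\,a(n)^2$ if $n$ is even; 2. $f_G(n)=r\,a(n)^2$ if $n$ is odd. -/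

import Mathlib

/-- A rooted spanning forest of `G`: a spanning acyclic subgraph `F` of `G` (on the full vertex
set) together with a set `R` of vertices (the roots) which contains exactly one vertex of each
connected component of `F`. -/
@[ext]
structure RootedSpanningForest {V : Type*} (G : SimpleGraph V) where
  /-- The underlying forest, a graph on the full vertex set. -/
  F : SimpleGraph V
  /-- The set of roots. -/
  R : Set V
  le : F ≤ G
  acyclic : F.IsAcyclic
  root : ∀ c : F.ConnectedComponent, ∃! v : V, v ∈ R ∧ F.connectedComponentMk v = c

/-- The number of rooted spanning forests of a (finite) graph. -/
noncomputable def numRootedSpanningForests {V : Type*} (G : SimpleGraph V) : ℕ :=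
  Nat.card (RootedSpanningForest G)

/-- A finite graph has finitely many rooted spanning forests, so the count above is genuine. -/
instance {V : Type*} [Finite V] (G : SimpleGraph V) : Finite (RootedSpanningForest G) :=
  Finite.of_injective (fun T : RootedSpanningForest G => (T.F, T.R)) (by
    intro S T h
    simp only [Prod.mk.injEq] at h
    exact RootedSpanningForest.ext h.1 h.2)

/-- The circulant graph `C_m(S)` on the vertices `0, …, m - 1` (the residues mod `m`): distinct
vertices are adjacent iff their difference mod `m` is `± s` for some jump `s ∈ S`. -/
def circulant (m : ℕ) (S : Set ℕ) : SimpleGraph (ZMod m) :=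
  SimpleGraph.circulantGraph ((fun s : ℕ => (s : ZMod m)) '' S)

/-- `q` is the square-free part of the positive integer `m`: `q` is square-free and
`m = q * t ^ 2` for a positive integer `t`. -/
def IsSquarefreePart (q m : ℕ) : Prop :=
  0 < q ∧ Squarefree q ∧ ∃ t : ℕ, 0 < t ∧ m = q * t ^ 2

/-!
The number of rooted spanning forests of a finite graph is `det (I + L)`, where `L` is the
Laplacian (`numRootedSpanningForests_eq_det`). Indeed, rooted spanning forests correspond to
parent functions `V → Option V` along edges whose iterates all reach `none`
(`numRootedSpanningForests_eq_card`). Expanding `det (I + L)` in its rows gives a sum of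
`det (I - P)` over all parent functions `φ` along edges, with `P` the transition matrix of `φ`, and
`det (I - P)` is `1` if `φ` terminates and `0` otherwise.

For the circulant graph on `ZMod (2 * n)`, `I + L` commutes with translations and with `x ↦ -x`.
Let `A` be the space of odd functions and `D f (x) = f (x + 1) - f (x - 1)`. The space of all
functions is the direct sum of the constants, the multiples of `(-1) ^ x`, `A` and `D A`, and `D`
identifies the action of `I + L` on `A` with that on `D A`. So `det (I + L)` is `c₀ * c₁ * d ^ 2`,
where `c₀` and `c₁` are the eigenvalues on the first two summands and `d` is the determinant on `A`
(`exists_det_eq_mul_sq`). Here `c₀ = 1`, and `c₁` is one plus twice the number of neighbours of the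
opposite parity, i.e. `1 + 2 * (2 * p)` or `1 + 2 * (2 * p + 1)` according to the parity of `n`
(`card_neighbors_parity_ne`).

It is enough to know that `d` is rational: if `q` is square-free and `q * y ^ 2` is an integer,
then the rational number `y` is an integer (`exists_int_of_squarefree_mul_sq`).
-/

/-! ### Rooted forests as parent functions -/

/-- The graph joining every vertex to its parent, for a parent function `φ` in which
`φ v = none` means that `v` is a root. -/
def parentGraph {V : Type*} (φ : V → Option V) : SimpleGraph V :=
  SimpleGraph.fromRel fun v w => φ v = some w

/-- A parent function is *terminating* if iterating it from any vertex arrives at a root, i.e. if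
the relation "is the parent of" is well founded. -/
def Terminating {V : Type*} (φ : V → Option V) : Prop :=
  WellFounded fun w v => φ v = some w

section ParentFunctions

variable {V : Type*} {φ ψ : V → Option V}

theorem SimpleGraph.Reachable.of_adj_closed {G : SimpleGraph V} {S : V → Prop}
    (hS : ∀ a b, G.Adj a b → S a → S b) {v w : V} (h : G.Reachable v w) (hv : S v) : S w := by
  obtain ⟨p⟩ := h
  induction p with
  | nil => exact hv
  | cons hadj _ ih => exact ih (hS _ _ hadj hv)

theorem Terminating.ne_some_self (h : Terminating φ) (v : V) : φ v ≠ some v :=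
  fun hv => h.irrefl.irrefl v hv

theorem Terminating.adj (h : Terminating φ) {v w : V} (hvw : φ v = some w) :
    (parentGraph φ).Adj v w :=
  (SimpleGraph.fromRel_adj _ _ _).2 ⟨fun e => h.ne_some_self v (by rw [hvw, e]), Or.inl hvw⟩

/-- The descendants of `u` are invariant under passing to parents and to children, except across
the edge from `u` to its own parent. -/
theorem ancestor_iff {a b u : V} (hab : φ a = some b) (hau : a ≠ u) :
    Relation.ReflTransGen (fun v w => φ v = some w) a u ↔
      Relation.ReflTransGen (fun v w => φ v = some w) b u := by
  constructor
  · intro h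
    rcases h.cases_head with h | ⟨c, hc, h⟩
    · exact absurd h hau
    · rw [hab] at hc
      cases hc
      exact h
  · exact fun h => h.head hab

theorem Terminating.not_ancestor (h : Terminating φ) {v w : V} (hvw : φ v = some w) :
    ¬ Relation.ReflTransGen (fun v w => φ v = some w) w v := by
  intro hwv
  have hloop : Relation.TransGen (fun w v => φ v = some w) v v := by
    refine Relation.TransGen.tail' ?_ (hvw : φ v = some w)
    rw [← Relation.reflTransGen_swap] at hwv
    exact hwv
  exact h.transGen.irrefl.irrefl v hloop

/-- The edge from `v` to its parent separates the descendants of `v` from all other vertices. -/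
theorem Terminating.isBridge (h : Terminating φ) {v w : V} (hvw : φ v = some w) :
    (parentGraph φ).IsBridge s(v, w) := by
  rw [SimpleGraph.isBridge_iff]
  intro hr
  refine h.not_ancestor hvw (hr.of_adj_closed
    (S := fun a => Relation.ReflTransGen (fun v w => φ v = some w) a v) ?_ .refl)
  intro a b hab ha
  rw [SimpleGraph.deleteEdges_adj, parentGraph, SimpleGraph.fromRel_adj] at hab
  obtain ⟨⟨-, hab | hba⟩, hne⟩ := hab
  · refine (ancestor_iff hab ?_).1 ha
    rintro rfl
    rw [hvw] at hab
    cases hab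
    exact hne rfl
  · exact ha.head hba

theorem Terminating.isAcyclic (h : Terminating φ) : (parentGraph φ).IsAcyclic := by
  rw [SimpleGraph.isAcyclic_iff_forall_adj_isBridge]
  intro v w hvw
  rw [parentGraph, SimpleGraph.fromRel_adj] at hvw
  obtain ⟨-, hvw | hwv⟩ := hvw
  · exact h.isBridge hvw
  · rw [Sym2.eq_swap]
    exact h.isBridge hwv

theorem Terminating.exists_root (h : Terminating φ) (v : V) :
    ∃ u, φ u = none ∧ (parentGraph φ).Reachable v u := by
  induction v using h.induction with
  | _ v ih =>
    cases hv : φ v with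
    | none => exact ⟨v, hv, .refl _⟩
    | some w =>
      obtain ⟨u, hu, hwu⟩ := ih w hv
      exact ⟨u, hu, (h.adj hv).reachable.trans hwu⟩

theorem root_unique {u v : V} (hu : φ u = none) (hv : φ v = none)
    (huv : (parentGraph φ).Reachable u v) : u = v := by
  have := huv.of_adj_closed
    (S := fun a => Relation.ReflTransGen (fun v w => φ v = some w) a u) ?_ .refl
  · rcases this.cases_head with h | ⟨c, hc, -⟩
    · exact h.symm
    · rw [hv] at hc
      cases hc
  · intro a b hab ha
    rw [parentGraph, SimpleGraph.fromRel_adj] at hab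
    obtain ⟨-, hab | hba⟩ := hab
    · refine (ancestor_iff hab ?_).1 ha
      rintro rfl
      rw [hu] at hab
      cases hab
    · exact ha.head hba

/-- The rooted spanning forest of `G` given by a terminating parent function along edges of `G`. -/
def Terminating.toForest (h : Terminating φ) (G : SimpleGraph V)
    (hG : ∀ v w, φ v = some w → G.Adj v w) : RootedSpanningForest G where
  F := parentGraph φ
  R := {v | φ v = none}
  le := by
    intro v w hvw
    rw [parentGraph, SimpleGraph.fromRel_adj] at hvw
    obtain ⟨-, hvw | hwv⟩ := hvw
    · exact hG _ _ hvw
    · exact (hG _ _ hwv).symm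
  acyclic := h.isAcyclic
  root := by
    intro c
    induction c using SimpleGraph.ConnectedComponent.ind with
    | _ v =>
      obtain ⟨u, hu, hvu⟩ := h.exists_root v
      refine ⟨u, ⟨hu, SimpleGraph.ConnectedComponent.sound hvu.symm⟩, ?_⟩
      rintro x ⟨hx, hxv⟩
      exact root_unique hx hu ((SimpleGraph.ConnectedComponent.exact hxv).trans hvu)

theorem Terminating.eq_of_parentGraph_eq (hφ : Terminating φ)
    (hF : parentGraph φ = parentGraph ψ) (hR : ∀ v, φ v = none ↔ ψ v = none) : φ = ψ := by
  funext v
  induction v using hφ.induction with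
  | _ v ih =>
    cases hv : φ v with
    | none => exact ((hR v).1 hv).symm
    | some w =>
      have hadj := hφ.adj hv
      rw [hF, parentGraph, SimpleGraph.fromRel_adj] at hadj
      obtain ⟨-, h | h⟩ := hadj
      · exact h.symm
      · -- `v` and `w` would be parents of each other under `φ`
        rw [← ih w hv] at h
        exact absurd (.single h) (hφ.not_ancestor hv)

/-- Every rooted spanning forest comes from a parent function: send a vertex to a neighbour that
is nearer to the root of its component. -/
theorem RootedSpanningForest.exists_terminating {G : SimpleGraph V}
    (T : RootedSpanningForest G) :
    ∃ (φ : V → Option V) (hφ : Terminating φ) (hG : ∀ v w, φ v = some w → G.Adj v w),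
      hφ.toForest G hG = T := by
  classical
  choose ρ hρ using fun c => (T.root c).exists
  let d : V → ℕ := fun v => T.F.dist v (ρ (T.F.connectedComponentMk v))
  have hstep : ∀ v, ∃ w, v ∉ T.R → T.F.Adj v w ∧ d w < d v := by
    intro v
    by_cases hv : v ∈ T.R
    · exact ⟨v, fun h => absurd hv h⟩
    have hr : T.F.Reachable v (ρ (T.F.connectedComponentMk v)) :=
      SimpleGraph.ConnectedComponent.exact (hρ _).2.symm
    obtain ⟨p, hp⟩ := hr.exists_walk_length_eq_dist
    have hmem := (hρ (T.F.connectedComponentMk v)).1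
    have hd : d v = p.length := hp.symm
    have key : ∀ (u : V) (p : T.F.Walk v u), u ∈ T.R →
        u = ρ (T.F.connectedComponentMk v) → d v = p.length →
        ∃ w, T.F.Adj v w ∧ d w < d v := by
      intro u p hu hu' hd
      cases p with
      | nil => exact absurd hu hv
      | @cons _ w _ hadj p =>
        refine ⟨w, hadj, ?_⟩
        have hc : T.F.connectedComponentMk w = T.F.connectedComponentMk v :=
          SimpleGraph.ConnectedComponent.sound hadj.symm.reachable
        rw [hd, SimpleGraph.Walk.length_cons]
        simp only [d]
        rw [hc, ← hu']
        exact Nat.lt_succ_of_le (SimpleGraph.dist_le p)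
    obtain ⟨w, hw⟩ := key _ p hmem rfl hd
    exact ⟨w, fun _ => hw⟩
  choose f hf using hstep
  let φ : V → Option V := fun v => if v ∈ T.R then none else some (f v)
  have hsome : ∀ v w, φ v = some w → v ∉ T.R ∧ f v = w := by
    intro v w h
    by_cases hv : v ∈ T.R <;> simp_all [φ]
  have hφ : Terminating φ := by
    refine Subrelation.wf (r := fun w v => d w < d v) ?_ (measure d).wf
    intro w v h
    obtain ⟨hv, rfl⟩ := hsome v w h
    exact (hf v hv).2
  have hF : ∀ v w, φ v = some w → T.F.Adj v w := by
    intro v w h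
    obtain ⟨hv, rfl⟩ := hsome v w h
    exact (hf v hv).1
  have hR : ∀ v, φ v = none ↔ v ∈ T.R := by
    intro v
    simp [φ]
  have hle : parentGraph φ ≤ T.F := (hφ.toForest T.F hF).le
  refine ⟨φ, hφ, fun v w h => T.le (hF v w h), ?_⟩
  refine RootedSpanningForest.ext (le_antisymm hle ?_) (Set.ext hR)
  -- An edge of `T.F` missing from the parent graph would be a bridge of `T.F` bypassed by the
  -- parent graph, in which both of its ends are connected to their common root.
  intro v w hvw
  by_contra hnot
  refine SimpleGraph.isAcyclic_iff_forall_adj_isBridge.1 T.acyclic hvw ?_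
  have hroot : ∀ x, (parentGraph φ).Reachable x (ρ (T.F.connectedComponentMk x)) := by
    intro x
    obtain ⟨u, hu, hxu⟩ := hφ.exists_root x
    have hux := SimpleGraph.ConnectedComponent.sound (hxu.mono hle).symm
    rwa [← (T.root _).unique ⟨(hR u).1 hu, hux⟩ (hρ _)]
  have hreach : (parentGraph φ).Reachable v w := by
    have hc : T.F.connectedComponentMk v = T.F.connectedComponentMk w :=
      SimpleGraph.ConnectedComponent.sound hvw.reachable
    have := hroot v
    rw [hc] at this
    exact this.trans (hroot w).symm
  refine hreach.mono fun a b hab => ?_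
  rw [SimpleGraph.deleteEdges_adj]
  refine ⟨hle hab, fun he => hnot ?_⟩
  rw [Set.mem_singleton_iff, Sym2.eq_iff] at he
  rcases he with ⟨rfl, rfl⟩ | ⟨rfl, rfl⟩
  · exact hab
  · exact hab.symm

theorem numRootedSpanningForests_eq_card (G : SimpleGraph V) :
    numRootedSpanningForests G =
      Nat.card {φ : V → Option V // (∀ v w, φ v = some w → G.Adj v w) ∧ Terminating φ} := by
  refine (Nat.card_congr (Equiv.ofBijective (fun φ => φ.2.2.toForest G φ.2.1) ⟨?_, ?_⟩)).symm
  · intro φ ψ h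
    refine Subtype.ext (φ.2.2.eq_of_parentGraph_eq (congrArg (·.F) h) fun v => ?_)
    exact Set.ext_iff.1 (congrArg (·.R) h) v
  · intro T
    obtain ⟨φ, hφ, hG, h⟩ := T.exists_terminating
    exact ⟨⟨φ, hG, hφ⟩, h⟩

end ParentFunctions

/-! ### The matrix-forest theorem -/

section MatrixForest

open Matrix

variable {V : Type*} [Fintype V] [DecidableEq V]

/-- The matrix `I - P`, where `P` is the transition matrix of the parent function `φ`. -/
def parentMatrix (φ : V → Option V) : Matrix V V ℚ :=
  Matrix.of fun v w => (if v = w then 1 else 0) - (if φ v = some w then 1 else 0)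

/-- Ordering the vertices by the rank of the parent relation makes `I - P` unitriangular. -/
theorem Terminating.det_parentMatrix {φ : V → Option V} (h : Terminating φ) :
    (parentMatrix φ).det = 1 := by
  classical
  have : IsWellFounded V (fun w v => φ v = some w) := ⟨h⟩
  let b : V → Ordinalᵒᵈ := fun v =>
    OrderDual.toDual (IsWellFounded.rank (fun w v => φ v = some w) v)
  have hb : ∀ v w, φ v = some w → b v < b w := fun v w hvw =>
    OrderDual.toDual_lt_toDual.2
      (IsWellFounded.rank_lt_of_rel (r := fun w v => φ v = some w) hvw)
  have htri : (parentMatrix φ).BlockTriangular b := by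
    intro v w hvw
    have h1 : v ≠ w := by rintro rfl; exact lt_irrefl _ hvw
    have h2 : φ v ≠ some w := fun h => lt_asymm hvw (hb v w h)
    simp [parentMatrix, h1, h2]
  rw [htri.det]
  refine Finset.prod_eq_one fun a _ => ?_
  suffices hone : (parentMatrix φ).toSquareBlock b a = 1 by rw [hone, Matrix.det_one]
  ext ⟨v, hv⟩ ⟨w, hw⟩
  have h2 : φ v ≠ some w := fun h => (hb v w h).ne (hv.trans hw.symm)
  simp [parentMatrix, Matrix.toSquareBlock, Matrix.toSquareBlockProp, h2, Matrix.one_apply]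

/-- If `φ` does not terminate, the indicator of the vertices from which no root is ever reached
is in the kernel of `I - P`. -/
theorem det_parentMatrix_of_not_terminating {φ : V → Option V} (h : ¬ Terminating φ) :
    (parentMatrix φ).det = 0 := by
  classical
  rw [← Matrix.exists_mulVec_eq_zero_iff]
  have : ∃ v, ¬ Acc (fun w v => φ v = some w) v := by
    by_contra! hc
    exact h ⟨hc⟩
  obtain ⟨v₀, hv₀⟩ := this
  refine ⟨fun v => if Acc (fun w v => φ v = some w) v then 0 else 1, ?_, ?_⟩
  · intro h0
    simpa [hv₀] using congrFun h0 v₀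
  · funext v
    simp only [mulVec, dotProduct, parentMatrix, Matrix.of_apply, sub_mul, Finset.sum_sub_distrib,
      ite_mul, one_mul, zero_mul, Finset.sum_ite_eq, Finset.mem_univ, if_true, Pi.zero_apply]
    cases hv : φ v with
    | none =>
      have hacc : Acc (fun w v => φ v = some w) v :=
        ⟨v, fun w hw => by rw [hv] at hw; cases hw⟩
      simp [hacc]
    | some u =>
      have hiff : Acc (fun w v => φ v = some w) v ↔ Acc (fun w v => φ v = some w) u := by
        refine ⟨fun hacc => hacc.inv hv, fun hacc => ⟨v, fun w hw => ?_⟩⟩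
        rw [hv] at hw
        cases hw
        exact hacc
      simp [hiff, Option.some.injEq]

/-- **Matrix-forest theorem**: the number of rooted spanning forests of `G` is `det (I + L)`. The
row of `I + L` at `v` is `e_v` plus the sum of `e_v - e_w` over the neighbours `w` of `v`;
expanding the determinant in its rows gives one term for every parent function along `G`. -/
theorem numRootedSpanningForests_eq_det (G : SimpleGraph V) [DecidableRel G.Adj] :
    (numRootedSpanningForests G : ℚ) = (1 + G.lapMatrix ℚ).det := by
  classical
  let A : V → Finset (Option V) := fun v => insert none ((G.neighborFinset v).image some)
  have hA : ∀ v o, o ∈ A v ↔ ∀ w, o = some w → G.Adj v w := by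
    intro v o
    cases o <;> simp [A]
  have hrow : 1 + G.lapMatrix ℚ =
      fun v => ∑ o ∈ A v, fun w => ((if v = w then 1 else 0) - (if o = some w then 1 else 0) : ℚ)
      := by
    ext v w
    rw [Finset.sum_apply, Finset.sum_insert (by simp),
      Finset.sum_image (fun _ _ _ _ h => Option.some_injective _ h), Finset.sum_sub_distrib]
    simp only [Finset.sum_const, Option.some.injEq, Finset.sum_ite_eq',
      SimpleGraph.mem_neighborFinset]
    simp [SimpleGraph.lapMatrix, SimpleGraph.degMatrix, Matrix.one_apply, Matrix.diagonal_apply]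
  have hexp : (1 + G.lapMatrix ℚ).det =
      ∑ φ ∈ Fintype.piFinset A, (parentMatrix φ).det := by
    rw [hrow]
    exact (Matrix.detRowAlternating (R := ℚ) (n := V)).toMultilinearMap.map_sum_finset
      (fun v o w => ((if v = w then 1 else 0) - (if o = some w then 1 else 0) : ℚ)) A
  rw [hexp, numRootedSpanningForests_eq_card, Nat.card_eq_fintype_card, Fintype.card_subtype,
    Finset.card_filter, Nat.cast_sum]
  rw [← Finset.sum_subset (Finset.subset_univ (Fintype.piFinset A))]
  · refine Finset.sum_congr rfl fun φ hφ => ?_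
    have hφ' : ∀ v w, φ v = some w → G.Adj v w := fun v =>
      (hA v _).1 (Fintype.mem_piFinset.1 hφ v)
    by_cases ht : Terminating φ
    · rw [if_pos ⟨hφ', ht⟩, ht.det_parentMatrix, Nat.cast_one]
    · rw [if_neg fun h => ht h.2, det_parentMatrix_of_not_terminating ht, Nat.cast_zero]
  · intro φ _ hφ
    rw [if_neg, Nat.cast_zero]
    exact fun h => hφ (Fintype.mem_piFinset.2 fun v => (hA v _).2 (h.1 v))

end MatrixForest

/-! ### Circulant operators on functions on `ZMod (2 * n)` -/

section Circulant

variable {n : ℕ}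

/-- Reduction modulo `2` on `ZMod (2 * n)`. -/
def parity (n : ℕ) : ZMod (2 * n) →+* ZMod 2 :=
  ZMod.castHom (dvd_mul_right 2 n) (ZMod 2)

/-- The alternating function `x ↦ (-1) ^ x` on `ZMod (2 * n)`. -/
def alternating (n : ℕ) : ZMod (2 * n) → ℚ :=
  fun x => if parity n x = 0 then 1 else -1

theorem alternating_mul_self (x : ZMod (2 * n)) : alternating n x * alternating n x = 1 := by
  unfold alternating
  split_ifs <;> norm_num

theorem alternating_neg (x : ZMod (2 * n)) : alternating n (-x) = alternating n x := by
  simp [alternating]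

theorem alternating_add_one (x : ZMod (2 * n)) : alternating n (x + 1) = -alternating n x := by
  have key : ∀ z : ZMod 2, (if z + 1 = 0 then (1 : ℚ) else -1) = -(if z = 0 then 1 else -1) := by
    intro z
    obtain rfl | rfl : z = 0 ∨ z = 1 := by revert z; decide
    · simp
    · simp [show (1 : ZMod 2) + 1 = 0 from rfl]
  simpa [alternating] using key (parity n x)

theorem eq_zero_of_periodic_two [NeZero n] {f : ZMod (2 * n) → ℚ} (hf : ∀ x, f (x + 1) = f (x - 1))
    (h0 : f 0 = 0) (h1 : f 1 = 0) : f = 0 := by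
  have hstep : ∀ x, f (x + 2) = f x := by
    intro x
    have := hf (x + 1)
    rwa [add_assoc, one_add_one_eq_two, add_sub_cancel_right] at this
  have hnat : ∀ j : ℕ, f (j : ZMod (2 * n)) = 0 ∧ f ((j + 1 : ℕ) : ZMod (2 * n)) = 0 := by
    intro j
    induction j with
    | zero => simp [h0, h1]
    | succ j ih =>
      refine ⟨ih.2, ?_⟩
      have := hstep (j : ZMod (2 * n))
      rw [ih.1] at this
      rw [← this]
      push_cast
      congr 1
      ring
  funext x
  rw [← ZMod.natCast_zmod_val x]
  exact (hnat x.val).1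

/-- The odd functions on `ZMod (2 * n)`. -/
def oddFunctions (n : ℕ) : Submodule ℚ (ZMod (2 * n) → ℚ) where
  carrier := {f | ∀ x, f (-x) = -f x}
  add_mem' {f g} hf hg x := by
    rw [Pi.add_apply, Pi.add_apply, hf, hg]
    ring
  zero_mem' x := by simp
  smul_mem' c f hf x := by
    rw [Pi.smul_apply, Pi.smul_apply, hf, smul_neg]

/-- The symmetric difference operator `f ↦ (x ↦ f (x + 1) - f (x - 1))`. It exchanges even and
odd functions and commutes with all circulant operators. -/
def symmDifference (n : ℕ) : (ZMod (2 * n) → ℚ) →ₗ[ℚ] (ZMod (2 * n) → ℚ) where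
  toFun f x := f (x + 1) - f (x - 1)
  map_add' f g := by
    funext x
    simp only [Pi.add_apply]
    ring
  map_smul' c f := by
    funext x
    simp only [Pi.smul_apply, smul_eq_mul, RingHom.id_apply]
    ring

theorem symmDifference_apply (f : ZMod (2 * n) → ℚ) (x : ZMod (2 * n)) :
    symmDifference n f x = f (x + 1) - f (x - 1) := rfl

/-- The map `(c₀, c₁, a, b) ↦ c₀ + c₁ (-1) ^ x + a + (symmetric difference of b)`, with `a` and `b`
odd. -/
def oddDecomposition (n : ℕ) :
    (ℚ × ℚ × oddFunctions n × oddFunctions n) →ₗ[ℚ] (ZMod (2 * n) → ℚ) :=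
  (LinearMap.toSpanSingleton ℚ _ 1).coprod <|
    (LinearMap.toSpanSingleton ℚ _ (alternating n)).coprod <|
      (oddFunctions n).subtype.coprod (symmDifference n ∘ₗ (oddFunctions n).subtype)

theorem oddDecomposition_apply (z : ℚ × ℚ × oddFunctions n × oddFunctions n) :
    oddDecomposition n z = z.1 • (1 : ZMod (2 * n) → ℚ) + (z.2.1 • alternating n +
      ((z.2.2.1 : ZMod (2 * n) → ℚ) + symmDifference n z.2.2.2)) := by
  simp [oddDecomposition, LinearMap.toSpanSingleton_apply]

theorem oddDecomposition_injective [NeZero n] : Function.Injective (oddDecomposition n) := by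
  rw [← LinearMap.ker_eq_bot, LinearMap.ker_eq_bot']
  rintro ⟨c₀, c₁, ⟨a, ha⟩, ⟨b, hb⟩⟩ h
  rw [oddDecomposition_apply] at h
  have hx : ∀ x, c₀ + (c₁ * alternating n x + (a x + (b (x + 1) - b (x - 1)))) = 0 := by
    intro x
    simpa [symmDifference_apply] using congrFun h x
  have ha0 : a = 0 := by
    funext x
    have h1 := hx x
    have h2 := hx (-x)
    rw [alternating_neg, ha x, show -x + 1 = -(x - 1) by ring, show -x - 1 = -(x + 1) by ring,
      hb, hb] at h2
    simp only [Pi.zero_apply]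
    linarith
  subst ha0
  simp only [Pi.zero_apply, zero_add] at hx
  have hcard : (Fintype.card (ZMod (2 * n)) : ℚ) ≠ 0 := Nat.cast_ne_zero.2 Fintype.card_ne_zero
  have hadd (f : ZMod (2 * n) → ℚ) : ∑ x, f (x + 1) = ∑ x, f x :=
    Equiv.sum_comp (Equiv.addRight 1) f
  have hsub (f : ZMod (2 * n) → ℚ) : ∑ x, f (x - 1) = ∑ x, f x :=
    Equiv.sum_comp (Equiv.subRight 1) f
  have halt : ∑ x, alternating n x = 0 := by
    have := hadd (alternating n)
    simp only [alternating_add_one, Finset.sum_neg_distrib] at this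
    linarith
  -- Summing over all `x` isolates `c₀`.
  have hc₀ : c₀ = 0 := by
    have hs : ∑ x : ZMod (2 * n), (c₀ + (c₁ * alternating n x + (b (x + 1) - b (x - 1)))) = 0 :=
      Finset.sum_eq_zero fun x _ => hx x
    rw [Finset.sum_add_distrib, Finset.sum_add_distrib, ← Finset.mul_sum, halt,
      Finset.sum_sub_distrib, hadd, hsub, sub_self, mul_zero, add_zero, add_zero,
      Finset.sum_const, Finset.card_univ, nsmul_eq_mul] at hs
    exact (mul_eq_zero.1 hs).resolve_left hcard
  subst hc₀
  -- Summing against the alternating function isolates `c₁`.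
  have hc₁ : c₁ = 0 := by
    have h1 := hadd (fun x => alternating n x * b x)
    have h2 := hsub (fun x => alternating n x * b x)
    have hsub1 : ∀ x, alternating n (x - 1) = -alternating n x := by
      intro x
      have := alternating_add_one (x - 1)
      rw [sub_add_cancel] at this
      linarith
    simp only [alternating_add_one, hsub1] at h1 h2
    have hs : ∑ x : ZMod (2 * n), (c₁ + (-(-alternating n x * b (x + 1)) +
        -alternating n x * b (x - 1))) = 0 := by
      refine Finset.sum_eq_zero fun x _ => ?_
      linear_combination alternating n x * hx x - c₁ * alternating_mul_self x
    rw [Finset.sum_add_distrib, Finset.sum_add_distrib, Finset.sum_neg_distrib, h1, h2,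
      neg_add_cancel, add_zero, Finset.sum_const, Finset.card_univ, nsmul_eq_mul] at hs
    exact (mul_eq_zero.1 hs).resolve_left hcard
  subst hc₁
  have hper : ∀ x, b (x + 1) = b (x - 1) := fun x => by linarith [hx x]
  have hb0 : b = 0 := by
    refine eq_zero_of_periodic_two hper ?_ ?_
    · have := hb 0
      rw [neg_zero] at this
      linarith
    · have h1 := hb 1
      have h2 := hper 0
      rw [zero_add, zero_sub] at h2
      linarith
  subst hb0
  rfl

/-- Dimension count: a function is determined by its values at `0` and `1`, its odd part and the
symmetric difference of its even part. -/
theorem finrank_function_le [NeZero n] :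
    Module.finrank ℚ (ZMod (2 * n) → ℚ) ≤
      Module.finrank ℚ (ℚ × ℚ × oddFunctions n × oddFunctions n) := by
  let σ : (ZMod (2 * n) → ℚ) →ₗ[ℚ] (ZMod (2 * n) → ℚ) := LinearMap.funLeft ℚ ℚ (fun x => -x)
  have hσ : ∀ f x, σ f x = f (-x) := fun _ _ => rfl
  let g₁ : (ZMod (2 * n) → ℚ) →ₗ[ℚ] oddFunctions n :=
    (LinearMap.id - σ).codRestrict _ fun f x => by simp [hσ]
  let g₂ : (ZMod (2 * n) → ℚ) →ₗ[ℚ] oddFunctions n :=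
    (symmDifference n ∘ₗ (LinearMap.id + σ)).codRestrict _ fun f x => by
      simp only [LinearMap.comp_apply, symmDifference_apply, LinearMap.add_apply,
        LinearMap.id_apply, Pi.add_apply, hσ]
      rw [show -(-x + 1) = x - 1 by ring, show -(-x - 1) = x + 1 by ring,
        show -x + 1 = -(x - 1) by ring, show -x - 1 = -(x + 1) by ring]
      ring
  let g : (ZMod (2 * n) → ℚ) →ₗ[ℚ] (ℚ × ℚ × oddFunctions n × oddFunctions n) :=
    (LinearMap.proj 0).prod ((LinearMap.proj 1).prod (g₁.prod g₂))
  refine LinearMap.finrank_le_finrank_of_injective (f := g) ?_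
  rw [← LinearMap.ker_eq_bot, LinearMap.ker_eq_bot']
  intro f hf
  have h0 : f 0 = 0 := congrArg (·.1) hf
  have h1 : f 1 = 0 := congrArg (·.2.1) hf
  have hg₁ : g₁ f = 0 := congrArg (·.2.2.1) hf
  have hg₂ : g₂ f = 0 := congrArg (·.2.2.2) hf
  have heven : ∀ x, f (-x) = f x := fun x => by
    have : f x - f (-x) = 0 := congrFun (congrArg Subtype.val hg₁) x
    linarith
  refine eq_zero_of_periodic_two (fun x => ?_) h0 h1
  have : f (x + 1) + f (-(x + 1)) - (f (x - 1) + f (-(x - 1))) = 0 :=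
    congrFun (congrArg Subtype.val hg₂) x
  rw [heven, heven] at this
  linarith

/-- Apart from its eigenvalues on the constant and the alternating function, a circulant operator
that commutes with the reflection has square determinant: the symmetric difference carries its
action on odd functions to its action on the rest of the even functions. -/
theorem exists_det_eq_mul_sq [NeZero n] (M : (ZMod (2 * n) → ℚ) →ₗ[ℚ] (ZMod (2 * n) → ℚ))
    (htrans : ∀ f d x, M (fun y => f (y + d)) x = M f (x + d))
    (hneg : ∀ f x, M (fun y => f (-y)) x = M f (-x))
    {c₀ c₁ : ℚ} (h₀ : M 1 = c₀ • 1) (h₁ : M (alternating n) = c₁ • alternating n) :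
    ∃ d : ℚ, LinearMap.det M = c₀ * c₁ * d ^ 2 := by
  have hodd : ∀ f ∈ oddFunctions n, M f ∈ oddFunctions n := by
    intro f hf x
    rw [← hneg, show (fun y => f (-y)) = -f from funext hf, map_neg, Pi.neg_apply]
  have hdiff : ∀ f, M (symmDifference n f) = symmDifference n (M f) := by
    intro f
    have : symmDifference n f = (fun y => f (y + 1)) - fun y => f (y + -1) := by
      funext x
      simp [symmDifference_apply, sub_eq_add_neg]
    funext x
    rw [this, map_sub, Pi.sub_apply, htrans, htrans, symmDifference_apply, sub_eq_add_neg x]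
  let M' : oddFunctions n →ₗ[ℚ] oddFunctions n := M.restrict hodd
  let e : (ℚ × ℚ × oddFunctions n × oddFunctions n) ≃ₗ[ℚ] (ZMod (2 * n) → ℚ) :=
    (oddDecomposition n).linearEquivOfInjective oddDecomposition_injective
      (le_antisymm (LinearMap.finrank_le_finrank_of_injective oddDecomposition_injective)
        finrank_function_le)
  have he : ∀ z, e z = oddDecomposition n z := fun _ => rfl
  let D : (ℚ × ℚ × oddFunctions n × oddFunctions n) →ₗ[ℚ]
      (ℚ × ℚ × oddFunctions n × oddFunctions n) :=
    (c₀ • LinearMap.id).prodMap ((c₁ • LinearMap.id).prodMap (M'.prodMap M'))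
  have hconj : M = (e : _ →ₗ[ℚ] _) ∘ₗ D ∘ₗ (e.symm : _ →ₗ[ℚ] _) := by
    refine LinearMap.ext fun f => ?_
    obtain ⟨z, rfl⟩ := e.surjective f
    rw [LinearMap.comp_apply, LinearMap.comp_apply, LinearEquiv.coe_coe, LinearEquiv.coe_coe,
      LinearEquiv.symm_apply_apply]
    simp only [he, oddDecomposition_apply, map_add, map_smul, h₀, h₁, hdiff]
    simp only [D, M', LinearMap.prodMap_apply, LinearMap.smul_apply, LinearMap.id_apply,
      smul_smul, smul_eq_mul, LinearMap.coe_restrict_apply, mul_comm]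
  refine ⟨LinearMap.det M', ?_⟩
  rw [hconj, LinearMap.det_conj, LinearMap.det_prodMap, LinearMap.det_prodMap,
    LinearMap.det_prodMap]
  simp only [LinearMap.det_ring, LinearMap.smul_apply, LinearMap.id_apply, smul_eq_mul, mul_one]
  ring

end Circulant

/-! ### The operator `I + L` of the circulant graph -/

section Forests

open scoped Matrix

variable {V : Type*} [Fintype V] [DecidableEq V] {G : SimpleGraph V} [DecidableRel G.Adj]

theorem one_add_lapMatrix_mulVec_apply (f : V → ℚ) (v : V) :
    ((1 + G.lapMatrix ℚ) *ᵥ f) v = f v + ∑ u ∈ G.neighborFinset v, (f v - f u) := by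
  rw [Matrix.add_mulVec, Matrix.one_mulVec, Pi.add_apply, G.lapMatrix_mulVec_apply,
    Finset.sum_sub_distrib, Finset.sum_const, nsmul_eq_mul, G.card_neighborFinset_eq_degree]

theorem one_add_lapMatrix_mulVec_comp (σ : V ≃ V) (hσ : ∀ u v, G.Adj (σ u) (σ v) ↔ G.Adj u v)
    (f : V → ℚ) (v : V) :
    ((1 + G.lapMatrix ℚ) *ᵥ fun u => f (σ u)) v = ((1 + G.lapMatrix ℚ) *ᵥ f) (σ v) := by
  rw [one_add_lapMatrix_mulVec_apply, one_add_lapMatrix_mulVec_apply]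
  congr 1
  refine Finset.sum_equiv σ (fun u => ?_) fun _ _ => rfl
  rw [SimpleGraph.mem_neighborFinset, SimpleGraph.mem_neighborFinset, hσ]

theorem circulant_adj_add {m : ℕ} {S : Set ℕ} (d u v : ZMod m) :
    (circulant m S).Adj (u + d) (v + d) ↔ (circulant m S).Adj u v :=
  SimpleGraph.circulantGraph_adj_translate

theorem circulant_adj_neg {m : ℕ} {S : Set ℕ} (u v : ZMod m) :
    (circulant m S).Adj (-u) (-v) ↔ (circulant m S).Adj u v := by
  simp only [circulant, SimpleGraph.circulantGraph_adj, neg_sub_neg, neg_inj]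
  tauto

theorem parity_natCast_eq_zero (n j : ℕ) : parity n (j : ZMod (2 * n)) = 0 ↔ ¬ Odd j := by
  rw [map_natCast, Nat.not_odd_iff_even, ZMod.natCast_eq_zero_iff_even]

/-- Each odd jump `j < n` contributes the two neighbours `v ± j` of the opposite parity, and the
jump `n`, if odd, contributes one. -/
theorem card_neighbors_parity_ne {n : ℕ} [NeZero n] (J : Finset ℕ) (hJ : ∀ j ∈ J, 0 < j ∧ j < n)
    [DecidableRel (circulant (2 * n) (J ∪ {n})).Adj] (v : ZMod (2 * n)) :
    (((circulant (2 * n) (J ∪ {n})).neighborFinset v).filter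
      fun u => parity n u ≠ parity n v).card =
      2 * (J.filter Odd).card + if Odd n then 1 else 0 := by
  have hn : 0 < n := Nat.pos_of_ne_zero (NeZero.ne n)
  let O : Finset ℕ := J.filter Odd
  have hO : ∀ j ∈ O, 0 < j ∧ j < n ∧ Odd j := fun j hj =>
    ⟨(hJ j (Finset.mem_filter.1 hj).1).1, (hJ j (Finset.mem_filter.1 hj).1).2,
      (Finset.mem_filter.1 hj).2⟩
  -- `K` represents the odd differences `u - v`, with `-i` represented by `2 * n - i`.
  let K : Finset ℕ := (O ∪ O.image (2 * n - ·)) ∪ (if Odd n then {n} else ∅)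
  have hK : ∀ j, j ∈ K ↔ (j ∈ O ∨ ∃ i ∈ O, 2 * n - i = j) ∨ (Odd n ∧ j = n) := by
    intro j
    by_cases h : Odd n <;> simp [K, h, or_comm]
  have hKcard : K.card = 2 * O.card + if Odd n then 1 else 0 := by
    rw [Finset.card_union_of_disjoint, Finset.card_union_of_disjoint, Finset.card_image_of_injOn]
    · split_ifs <;> simp [two_mul]
    · intro i hi j hj hij
      have := hO i hi
      have := hO j hj
      simp only at hij
      omega
    · rw [Finset.disjoint_left]
      intro j hj hj'
      obtain ⟨i, hi, rfl⟩ := Finset.mem_image.1 hj'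
      have := hO i hi
      have := hO _ hj
      omega
    · rw [Finset.disjoint_left]
      intro j hj hj'
      have hjn : j = n := by
        split_ifs at hj' <;> simp_all
      rcases Finset.mem_union.1 hj with h | h
      · have := hO _ h
        omega
      · obtain ⟨i, hi, rfl⟩ := Finset.mem_image.1 h
        have := hO i hi
        omega
  have hKodd : ∀ j ∈ K, j < 2 * n ∧ Odd j := by
    intro j hj
    rcases (hK j).1 hj with (h | ⟨i, hi, rfl⟩) | ⟨h, rfl⟩
    · have := hO j h
      exact ⟨by omega, this.2.2⟩
    · obtain ⟨h1, h2, h3⟩ := hO i hi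
      exact ⟨by omega, Nat.Even.sub_odd (by omega) (even_two_mul n) h3⟩
    · exact ⟨by omega, h⟩
  have hcast : ∀ i, i < n → ((2 * n - i : ℕ) : ZMod (2 * n)) = -(i : ZMod (2 * n)) := by
    intro i hi
    rw [Nat.cast_sub (by omega), ZMod.natCast_self, zero_sub]
  have hnn : -(n : ZMod (2 * n)) = n := by
    rw [neg_eq_iff_add_eq_zero, ← Nat.cast_add, ← two_mul, ZMod.natCast_self]
  change _ = 2 * O.card + _
  rw [← hKcard]
  symm
  refine Finset.card_bij (fun j _ => v + (j : ZMod (2 * n))) ?_ ?_ ?_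
  · intro j hj
    have hpar : parity n (v + (j : ZMod (2 * n))) ≠ parity n v := by
      rw [map_add, Ne, add_eq_left, parity_natCast_eq_zero, not_not]
      exact (hKodd j hj).2
    rw [Finset.mem_filter, SimpleGraph.mem_neighborFinset]
    refine ⟨?_, hpar⟩
    rw [circulant, SimpleGraph.circulantGraph_adj]
    refine ⟨fun h => hpar (by rw [← h]), ?_⟩
    rw [sub_add_cancel_left, add_sub_cancel_left]
    rcases (hK j).1 hj with (h | ⟨i, hi, rfl⟩) | ⟨h, rfl⟩
    · exact Or.inr ⟨j, Or.inl (Finset.mem_filter.1 h).1, rfl⟩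
    · rw [hcast i (hO i hi).2.1, neg_neg]
      exact Or.inl ⟨i, Or.inl (Finset.mem_filter.1 hi).1, rfl⟩
    · exact Or.inr ⟨j, Or.inr rfl, rfl⟩
  · intro i hi j hj hij
    have h := congrArg ZMod.val (add_left_cancel hij)
    rwa [ZMod.val_cast_of_lt (hKodd i hi).1, ZMod.val_cast_of_lt (hKodd j hj).1] at h
  · intro u hu
    rw [Finset.mem_filter, SimpleGraph.mem_neighborFinset, circulant,
      SimpleGraph.circulantGraph_adj] at hu
    obtain ⟨⟨-, hadj⟩, hpar⟩ := hu
    have hodd : ∀ i : ℕ, u = v + i ∨ u = v - i → Odd i := by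
      intro i hi
      by_contra hcon
      rw [← parity_natCast_eq_zero n] at hcon
      rcases hi with rfl | rfl <;> simp [map_add, map_sub, hcon] at hpar
    rcases hadj with ⟨i, hi | hi, hiu⟩ | ⟨i, hi | hi, hiu⟩
    · have hu : u = v - i := by linear_combination (hiu : (i : ZMod (2 * n)) = v - u)
      have hiO : i ∈ O := Finset.mem_filter.2 ⟨hi, hodd i (Or.inr hu)⟩
      refine ⟨2 * n - i, (hK _).2 (Or.inl (Or.inr ⟨i, hiO, rfl⟩)), ?_⟩
      rw [hcast i (hO i hiO).2.1, hu, sub_eq_add_neg]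
    · have hu : u = v - i := by linear_combination (hiu : (i : ZMod (2 * n)) = v - u)
      obtain rfl : i = n := hi
      refine ⟨i, (hK _).2 (Or.inr ⟨hodd i (Or.inr hu), rfl⟩), ?_⟩
      rw [hu, sub_eq_add_neg, hnn]
    · have hu : u = v + i := by linear_combination -(hiu : (i : ZMod (2 * n)) = u - v)
      exact ⟨i, (hK _).2 (Or.inl (Or.inl (Finset.mem_filter.2 ⟨hi, hodd i (Or.inl hu)⟩))), hu.symm⟩
    · have hu : u = v + i := by linear_combination -(hiu : (i : ZMod (2 * n)) = u - v)
      obtain rfl : i = n := hi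
      exact ⟨i, (hK _).2 (Or.inr ⟨hodd i (Or.inl hu), rfl⟩), hu.symm⟩

/-- The eigenvalue of `I + L` on constants is `1`. On the alternating function it is `1` plus twice
the number of neighbours of the opposite parity. -/
theorem exists_numRootedSpanningForests_circulant {n : ℕ} (hn : 0 < n) (J : Finset ℕ)
    (hJ : ∀ j ∈ J, 0 < j ∧ j < n) :
    ∃ d : ℚ, (numRootedSpanningForests (circulant (2 * n) (J ∪ {n})) : ℚ) =
      ((4 * (J.filter Odd).card + if Odd n then 3 else 1 : ℕ) : ℚ) * d ^ 2 := by
  classical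
  have : NeZero n := ⟨hn.ne'⟩
  let G := circulant (2 * n) (J ∪ {n})
  obtain ⟨d, hd⟩ := exists_det_eq_mul_sq (Matrix.toLin' (1 + G.lapMatrix ℚ))
    (c₀ := 1) (c₁ := ((4 * (J.filter Odd).card + if Odd n then 3 else 1 : ℕ) : ℚ))
    (fun f d x => one_add_lapMatrix_mulVec_comp (Equiv.addRight d) (circulant_adj_add d) f x)
    (fun f x => one_add_lapMatrix_mulVec_comp (Equiv.neg _) circulant_adj_neg f x)
    (by
      funext x
      rw [Matrix.toLin'_apply, one_add_lapMatrix_mulVec_apply]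
      simp)
    (by
      funext x
      rw [Matrix.toLin'_apply, one_add_lapMatrix_mulVec_apply]
      have hterm : ∀ u, alternating n x - alternating n u =
          if parity n u ≠ parity n x then 2 * alternating n x else 0 := by
        have key : ∀ y z : ZMod 2, (if z = 0 then (1 : ℚ) else -1) - (if y = 0 then 1 else -1) =
            if y ≠ z then 2 * (if z = 0 then 1 else -1) else 0 := by
          intro y z
          obtain rfl | rfl : y = 0 ∨ y = 1 := by revert y; decide
          all_goals
            obtain rfl | rfl : z = 0 ∨ z = 1 := by revert z; decide
            all_goals norm_num
        exact fun u => key _ _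
      simp only [hterm]
      rw [← Finset.sum_filter, Finset.sum_const, card_neighbors_parity_ne J hJ, nsmul_eq_mul,
        Pi.smul_apply, smul_eq_mul]
      split_ifs <;> push_cast <;> ring)
  refine ⟨d, ?_⟩
  rw [numRootedSpanningForests_eq_det, ← LinearMap.det_toLin', hd, one_mul]

end Forests

/-! ### Square-free parts -/

theorem exists_int_of_squarefree_mul_sq {q : ℕ} (hq : Squarefree q) {y : ℚ} {m : ℕ}
    (h : (m : ℚ) = q * y ^ 2) : ∃ a : ℤ, (m : ℤ) = q * a ^ 2 := by
  have hden : (y.den : ℚ) ≠ 0 := Nat.cast_ne_zero.2 y.den_ne_zero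
  have hmul : (m : ℤ) * y.den ^ 2 = q * y.num ^ 2 := by
    have : (m : ℚ) * y.den ^ 2 = q * y.num ^ 2 := by
      rw [h, mul_assoc, ← mul_pow, Rat.mul_den_eq_num]
    exact_mod_cast this
  have hcop : IsCoprime ((y.den : ℤ) ^ 2) (y.num ^ 2) := by
    refine IsCoprime.pow ?_
    rw [Int.isCoprime_iff_gcd_eq_one, Int.gcd_comm]
    exact y.reduced
  have hdvd : (y.den : ℤ) ^ 2 ∣ q := hcop.dvd_of_dvd_mul_right ⟨m, by rw [← hmul, mul_comm]⟩
  have hone : y.den = 1 := by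
    have h' : y.den * y.den ∣ q := by
      rw [← sq]
      exact_mod_cast hdvd
    exact Nat.isUnit_iff.1 (hq _ h')
  refine ⟨y.num, ?_⟩
  simpa [hone] using hmul

theorem exists_int_of_isSquarefreePart {q N m : ℕ} (hq : IsSquarefreePart q N) {d : ℚ}
    (h : (m : ℚ) = (N : ℚ) * d ^ 2) : ∃ a : ℤ, (m : ℤ) = q * a ^ 2 := by
  obtain ⟨-, hsq, t, -, rfl⟩ := hq
  refine exists_int_of_squarefree_mul_sq hsq (y := t * d) ?_
  rw [h]
  push_cast
  ring

theorem theorem4 (k : ℕ) (s : Fin k → ℕ) (hs_pos : ∀ i, 1 ≤ s i) (hs_mono : StrictMono s)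
    (p : ℕ) (hp : p = (Finset.univ.filter (fun i : Fin k => Odd (s i))).card)
    (q r : ℕ) (hq : IsSquarefreePart q (4 * p + 1)) (hr : IsSquarefreePart r (4 * p + 3)) :
    ∃ a : ℕ → ℤ, ∀ n : ℕ, 0 < n → (∀ i, s i < n) →
      (Even n → (numRootedSpanningForests (circulant (2 * n) (Set.range s ∪ {n})) : ℤ)
        = (q : ℤ) * a n ^ 2) ∧
      (Odd n → (numRootedSpanningForests (circulant (2 * n) (Set.range s ∪ {n})) : ℤ)
        = (r : ℤ) * a n ^ 2) := by
  classical
  let J : Finset ℕ := Finset.univ.image s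
  have hJ : (J : Set ℕ) = Set.range s := by simp [J]
  have hcard : (J.filter Odd).card = p := by
    rw [hp, Finset.filter_image, Finset.card_image_of_injective _ hs_mono.injective]
  have key : ∀ n : ℕ, ∃ a : ℤ, 0 < n → (∀ i, s i < n) →
      (Even n → (numRootedSpanningForests (circulant (2 * n) (Set.range s ∪ {n})) : ℤ)
        = (q : ℤ) * a ^ 2) ∧
      (Odd n → (numRootedSpanningForests (circulant (2 * n) (Set.range s ∪ {n})) : ℤ)
        = (r : ℤ) * a ^ 2) := by
    intro n
    by_cases hn : 0 < n ∧ ∀ i, s i < n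
    · obtain ⟨d, hd⟩ := exists_numRootedSpanningForests_circulant hn.1 J (by
        intro j hj
        obtain ⟨i, -, rfl⟩ := Finset.mem_image.1 hj
        exact ⟨hs_pos i, hn.2 i⟩)
      rw [hJ, hcard] at hd
      by_cases hodd : Odd n
      · rw [if_pos hodd] at hd
        obtain ⟨a, ha⟩ := exists_int_of_isSquarefreePart hr hd
        exact ⟨a, fun _ _ => ⟨fun h => absurd h (Nat.not_even_iff_odd.2 hodd), fun _ => ha⟩⟩
      · rw [if_neg hodd] at hd
        obtain ⟨a, ha⟩ := exists_int_of_isSquarefreePart hq hd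
        exact ⟨a, fun _ _ => ⟨fun _ => ha, fun h => absurd h hodd⟩⟩
    · exact ⟨0, fun h0 h1 => absurd ⟨h0, h1⟩ hn⟩
  choose a ha using key
  exact ⟨a, ha⟩
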